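/- Let $\mathbb T$ be the unit circle with normalized Lebesgue measure, let $L^2_{\mathbb C^n}$ be the Hilbert space of square-integrable $\mathbb C^n$-valued functions on $\mathbb T$, $H^2_{\mathbb C^n}$ its closed subspace of functions whose Fourier coefficients of negative index vanish, and $P$ the orthogonal projection of $L^2_{\mathbb C^n}$ onto $H^2_{\mathbb C^n}$. For an essentially bounded $\Psi:\mathbb T\to M_n(\mathbb C)$ (that is, $\Psi\in L^\infty_{M_n}$), define on $f\in H^2_{\mathbb C^n}$ the block Toeplitz operator $T_\Psi f=P(\Psi f)$ and the block Hankel operator $H_\Psi f=J\big((I-P)(\Psi f)\big)$, where $(Jg)(z)=\overline z\,g(\overline z)$. Write $\Psi^*$ for the pointwise adjoint and $\overline\Psi$ for the entrywise complex conjugate of $\Psi$. A scalar function is of bounded type if it equals a.e. a quotient $\phi_1/\phi_2$ with $\phi_1,\phi_2\in H^\infty(\mathbb T)$ ($\phi_2\neq 0$ a.e.), and $\Psi$ is of bounded type if each of its entries is. A finite Blaschke–Potapov product is a function $$Q(z)=v\prod_{m=1}^{M}\big(b_m(z)P_m+(I-P_m)\big),\qquad b_m(z)=\frac{z-\alpha_m}{1-\overline{\alpha_m}z},\quad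 |\alpha_m|<1,$$ with $M\ge 0$, $v$ a constant unitary $n\times n$ matrix and $P_m$ orthogonal projections in $\mathbb C^n$. A bounded operator on a Hilbert space is subnormal if it is the restriction of a normal operator on a (possibly larger) Hilbert space to an invariant subspace. **Theorem.** Let $\Phi\in L^\infty_{M_n}$ satisfy $\Phi=Q\Phi^*$ a.e. on $\mathbb T$, where $Q$ is a finite Blaschke–Potapov product, and suppose that $\Phi^*$ is not of bounded type. Assume that $T_{\Phi^*}$ and $H_{\overline\Phi}$ are both injective. If $T_\Phi$ is subnormal, then $T_\Phi$ is normal. -/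

import Mathlib

open MeasureTheory AddCircle
open scoped ENNReal Matrix Matrix.Norms.L2Operator

noncomputable section

namespace BlockToeplitz

/-- The normalized Lebesgue measure on the unit circle. The circle is parametrized by
`t : UnitAddCircle = ℝ / ℤ`, the corresponding point being `z = AddCircle.toCircle t = exp (2πit)`;
thus `fourier k t = z ^ k`, and complex conjugation `z ↦ conj z` is `t ↦ -t`. -/
abbrev circleMeasure : Measure UnitAddCircle := haarAddCircle

/-- Membership of a scalar function in `H^∞`: it is essentially bounded and its Fourier
coefficients of negative index vanish. -/
def IsHInfty (f : UnitAddCircle → ℂ) : Prop :=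
  MemLp f ∞ circleMeasure ∧ ∀ k : ℤ, k < 0 → fourierCoeff f k = 0

/-- A scalar function is of bounded type if it is a quotient of two `H^∞` functions. -/
def IsBoundedType (f : UnitAddCircle → ℂ) : Prop :=
  ∃ f₁ f₂ : UnitAddCircle → ℂ, IsHInfty f₁ ∧ IsHInfty f₂ ∧
    (∀ᵐ t ∂circleMeasure, f₂ t ≠ 0) ∧ (∀ᵐ t ∂circleMeasure, f t = f₁ t / f₂ t)

/-- A matrix-valued function is of bounded type if each of its entries is. -/
def IsBoundedTypeMatrix {n : ℕ} (Φ : UnitAddCircle → Matrix (Fin n) (Fin n) ℂ) : Prop :=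
  ∀ i j, IsBoundedType (fun t => Φ t i j)

/-- The Blaschke factor `(z - α) / (1 - conj α * z)`. -/
def blaschkeFactor (α z : ℂ) : ℂ := (z - α) / (1 - star α * z)

/-- Finite Blaschke–Potapov products
`Q(z) = v * ∏_{m < M} (b_m(z) P_m + (I - P_m))`, the factors being multiplied in the order of
the index `m`, as functions on the closed unit disc. -/
def IsFiniteBlaschkePotapov {n : ℕ} (Q : ℂ → Matrix (Fin n) (Fin n) ℂ) : Prop :=
  ∃ (v : Matrix (Fin n) (Fin n) ℂ) (M : ℕ) (α : Fin M → ℂ)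
    (P : Fin M → Matrix (Fin n) (Fin n) ℂ),
    v ∈ Matrix.unitaryGroup (Fin n) ℂ ∧ (∀ m, ‖α m‖ < 1) ∧ (∀ m, IsStarProjection (P m)) ∧
    ∀ z, ‖z‖ ≤ 1 → Q z = v * (List.ofFn fun m => blaschkeFactor (α m) z • P m + (1 - P m)).prod

/-- The space `L²` of `ℂⁿ`-valued functions on the circle. -/
abbrev L2 (n : ℕ) : Type := Lp (EuclideanSpace ℂ (Fin n)) 2 circleMeasure

theorem integrable_L2 {n : ℕ} (f : L2 n) : Integrable f circleMeasure :=
  (Lp.memLp f).integrable (by norm_num)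

/-- The `k`-th Fourier coefficient as a bounded linear map on `L²`. -/
def fourierCoeffL (n : ℕ) (k : ℤ) : L2 n →L[ℂ] EuclideanSpace ℂ (Fin n) :=
  LinearMap.mkContinuous
    { toFun := fun f => fourierCoeff f k
      map_add' := fun f g => by
        rw [fourierCoeff_congr_ae (Lp.coeFn_add f g),
          fourierCoeff.add (integrable_L2 f) (integrable_L2 g)]
        rfl
      map_smul' := fun c f => by
        rw [fourierCoeff_congr_ae (Lp.coeFn_smul c f), fourierCoeff.const_smul]
        rfl } 1 (by
    intro f
    have h1 : ‖fourierCoeff f k‖ ≤ ∫ t, ‖f t‖ ∂circleMeasure := by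
      refine (norm_integral_le_integral_norm _).trans (le_of_eq ?_)
      refine integral_congr_ae (Filter.Eventually.of_forall fun t => ?_)
      beta_reduce
      rw [norm_smul, fourier_apply, Circle.norm_coe, one_mul]
    have h2 : ∫ t, ‖f t‖ ∂circleMeasure = (eLpNorm f 1 circleMeasure).toReal := by
      rw [integral_norm_eq_lintegral_enorm (integrable_L2 f).1, eLpNorm_one_eq_lintegral_enorm]
    have h3 : (eLpNorm f 1 circleMeasure).toReal ≤ ‖f‖ := by
      rw [Lp.norm_def]
      exact ENNReal.toReal_mono (Lp.eLpNorm_ne_top f)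
        (eLpNorm_le_eLpNorm_of_exponent_le (by norm_num) (Lp.aestronglyMeasurable f))
    rw [one_mul]
    exact (h1.trans h2.le).trans h3)

/-- The Hardy space `H²` of `ℂⁿ`-valued functions: the functions in `L²` whose Fourier
coefficients of negative index vanish. -/
def H2 (n : ℕ) : Submodule ℂ (L2 n) where
  carrier := {f | ∀ k : ℤ, k < 0 → fourierCoeff f k = 0}
  add_mem' := by
    intro f g hf hg k hk
    change fourierCoeffL n k (f + g) = 0
    rw [map_add]
    change fourierCoeff f k + fourierCoeff g k = 0
    rw [hf k hk, hg k hk, add_zero]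
  zero_mem' := fun k _ => map_zero (fourierCoeffL n k)
  smul_mem' := by
    intro c f hf k hk
    change fourierCoeffL n k (c • f) = 0
    rw [map_smul]
    change c • fourierCoeff f k = 0
    rw [hf k hk, smul_zero]

theorem isClosed_H2 (n : ℕ) : IsClosed (H2 n : Set (L2 n)) := by
  have h : (H2 n : Set (L2 n)) = ⋂ k : ℤ, ⋂ _ : k < 0, {f | fourierCoeffL n k f = 0} := by
    ext f
    simp only [Set.mem_iInter]
    rfl
  rw [h]
  exact isClosed_iInter fun k => isClosed_iInter fun _ =>
    isClosed_eq (fourierCoeffL n k).continuous continuous_const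

instance (n : ℕ) : CompleteSpace (H2 n) := (isClosed_H2 n).completeSpace_coe

/-- The action of matrices on `ℂⁿ`, as a bounded bilinear map. -/
def matrixAction (n : ℕ) : Matrix (Fin n) (Fin n) ℂ →L[ℂ]
    EuclideanSpace ℂ (Fin n) →L[ℂ] EuclideanSpace ℂ (Fin n) :=
  LinearMap.toContinuousLinearMap
    (Matrix.toEuclideanCLM (n := Fin n) (𝕜 := ℂ)).toAlgEquiv.toLinearMap

/-- Multiplication `f ↦ Φ f` on `L²` by an essentially bounded matrix-valued function `Φ`. -/
def mulOp {n : ℕ} (Φ : UnitAddCircle → Matrix (Fin n) (Fin n) ℂ)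
    (hΦ : MemLp Φ ∞ circleMeasure) : L2 n →L[ℂ] L2 n :=
  (matrixAction n).holderL circleMeasure ∞ 2 2 (hΦ.toLp Φ)

/-- The block Toeplitz operator `T_Φ f = P (Φ f)` on `H²`. -/
def toeplitz {n : ℕ} (Φ : UnitAddCircle → Matrix (Fin n) (Fin n) ℂ)
    (hΦ : MemLp Φ ∞ circleMeasure) : H2 n →L[ℂ] H2 n :=
  (H2 n).orthogonalProjectionOnto ∘L mulOp Φ hΦ ∘L (H2 n).subtypeL

theorem memLp_conj_smul_one (n : ℕ) :
    MemLp (fun t : UnitAddCircle => fourier (-1) t • (1 : Matrix (Fin n) (Fin n) ℂ))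
      ∞ circleMeasure := by
  refine memLp_top_of_bound (C := ‖(1 : Matrix (Fin n) (Fin n) ℂ)‖) ?_ ?_
  · exact ((fourier (-1)).continuous.smul continuous_const).aestronglyMeasurable
  · refine Filter.Eventually.of_forall fun t => ?_
    rw [norm_smul, fourier_apply, Circle.norm_coe, one_mul]

/-- The operator `(J f)(z) = conj z • f (conj z)` on `L²`. -/
def flipOp (n : ℕ) : L2 n →L[ℂ] L2 n :=
  mulOp _ (memLp_conj_smul_one n) ∘L
    (Lp.compMeasurePreservingₗᵢ ℂ (fun t : UnitAddCircle => -t)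
      (Measure.measurePreserving_neg circleMeasure)).toContinuousLinearMap

/-- The block Hankel operator `H_Φ f = J (P^⊥ (Φ f))` for `f ∈ H²`, where `P^⊥` is the orthogonal
projection onto the orthogonal complement of `H²`. It is regarded as a map into `L²`; as `J` maps
the orthogonal complement of `H²` onto `H²`, its values lie in `H²`. -/
def hankel {n : ℕ} (Φ : UnitAddCircle → Matrix (Fin n) (Fin n) ℂ)
    (hΦ : MemLp Φ ∞ circleMeasure) : H2 n →L[ℂ] L2 n :=
  flipOp n ∘L (H2 n)ᗮ.starProjection ∘L mulOp Φ hΦ ∘L (H2 n).subtypeL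

/-- A bounded operator `T` on a Hilbert space `H` is subnormal if it has a normal extension: there
are a Hilbert space `K`, an isometric embedding `V : H → K` and a normal operator `N` on `K` which
leaves (the copy of) `H` invariant and restricts to `T` there. -/
def IsSubnormal.{u} {H : Type u} [NormedAddCommGroup H] [InnerProductSpace ℂ H] [CompleteSpace H]
    (T : H →L[ℂ] H) : Prop :=
  ∃ (K : Type u) (_ : NormedAddCommGroup K) (_ : InnerProductSpace ℂ K) (_ : CompleteSpace K)
    (V : H →ₗᵢ[ℂ] K) (N : K →L[ℂ] K), IsStarNormal N ∧ ∀ x, N (V x) = V (T x)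

/-- The pointwise adjoint `Φ^*` of an essentially bounded `Φ` is essentially bounded. -/
theorem memLp_conjTranspose {n : ℕ} {Φ : UnitAddCircle → Matrix (Fin n) (Fin n) ℂ}
    (hΦ : MemLp Φ ∞ circleMeasure) : MemLp (fun t => (Φ t)ᴴ) ∞ circleMeasure :=
  hΦ.of_le (Continuous.comp_aestronglyMeasurable (g := fun A : Matrix (Fin n) (Fin n) ℂ => Aᴴ)
    (by fun_prop) hΦ.1) (Filter.Eventually.of_forall fun t =>
      (Matrix.l2_opNorm_conjTranspose (Φ t)).le)

/-- The entrywise complex conjugate of an essentially bounded `Φ` is essentially bounded. -/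
theorem memLp_map_star {n : ℕ} {Φ : UnitAddCircle → Matrix (Fin n) (Fin n) ℂ}
    (hΦ : MemLp Φ ∞ circleMeasure) : MemLp (fun t => (Φ t).map star) ∞ circleMeasure := by
  let L : Matrix (Fin n) (Fin n) ℂ →L[ℂ] Matrix (Fin n) (Fin n) ℂ :=
    LinearMap.toContinuousLinearMap
      (Matrix.transposeLinearEquiv (Fin n) (Fin n) ℂ ℂ).toLinearMap
  exact L.comp_memLp' (memLp_conjTranspose hΦ)

end BlockToeplitz

end

/-!
Write `P` for the projection onto `H²`, `T = T_Φ`, and `V = T_Q`, the restriction to `H²` of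
multiplication by `Q`. As `Q` is inner, `V` is an isometry, and `Φ = Q Φ*` gives `V† T = T†`.
Consequently `T† T - T T† = R† R` with `R = T - V T† = P Q (1 - P) Φ*|_{H²}`. As `Q` is a finite
Blaschke–Potapov product, `P Q (1 - P)` has finite rank: the Fourier coefficients of `G u`, for `G`
a single factor, satisfy a first-order recursion (`isFiniteRankInner_of_recursion`), and the
property passes to products (`IsFiniteRankInner.mul`).

For subnormal `T` the kernel of the self-commutator is `T`-invariant (`IsSubnormal.norm_map_map`),
so the finite-dimensional space `range R†` is `T†`-invariant. Since `R† = T†` on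
`ker V† = H² ⊖ Q H²`, which contains `range R`, injectivity of `T† = T_{Φ*}` shows that `ker V†` is
`T†`-invariant, and this amounts to `T V = V T` (`comp_comm_of_subnormal`), i.e. to
`P Q (1 - P) Φ = 0` on `H²`.

Injectivity of the Hankel operator with symbol `conj Φ` says that `Φ v ⊥ H²` and `v ⊥ H²` only for
`v = 0` (`eq_zero_of_mulOp_mem_orthogonal`). Thus `(1 - P) Φ` has dense range in the complement of
`H²`, so `Q` maps this complement into itself. Then `V` is unitary, `V† R = 0` forces `R = 0`, and
`T` is normal (`isStarNormal_compression`).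
-/

namespace BlockToeplitz

open ContinuousLinearMap

/-! ### Subnormal operators with a finite-rank defect -/

section Abstract

universe u

variable {H : Type u} [NormedAddCommGroup H] [InnerProductSpace ℂ H] [CompleteSpace H]

theorem norm_map_eq_norm_adjoint_map {N : H →L[ℂ] H} (hN : IsStarNormal N) (x : H) :
    ‖N x‖ = ‖N.adjoint x‖ := by
  exact ContinuousLinearMap.isStarNormal_iff_norm_eq_adjoint.mp hN x

/-- For subnormal `T`, the set of `x` with `‖T x‖ = ‖T† x‖` (the kernel of the self-commutator) is
`T`-invariant: if `N` is a normal extension, `‖T x‖ = ‖T† x‖` means that `N† x` stays in the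
smaller space, and then so does `N† (T x) = N (N† x)`. -/
theorem IsSubnormal.norm_map_map {T : H →L[ℂ] H} (hT : IsSubnormal T) {x : H}
    (hx : ‖T x‖ = ‖T.adjoint x‖) : ‖T (T x)‖ = ‖T.adjoint (T x)‖ := by
  obtain ⟨L, _, _, _, V, N, hN, hV⟩ := hT
  have hadj : ∀ y, V.toContinuousLinearMap.adjoint (N.adjoint (V y)) = T.adjoint y := by
    intro y
    refine ext_inner_right ℂ fun z => ?_
    rw [adjoint_inner_left, adjoint_inner_left, adjoint_inner_left]
    change inner ℂ (V y) (N (V z)) = _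
    rw [hV, V.inner_map_map]
  have hVV : ∀ y, V.toContinuousLinearMap.adjoint (V y) = y := by
    intro y
    refine ext_inner_right ℂ fun z => ?_
    rw [adjoint_inner_left]
    exact V.inner_map_map y z
  have hinv : N.adjoint (V x) = V (T.adjoint x) := by
    -- `V (T† x)` is the orthogonal projection of `N† (V x)`; equal norms force equality.
    rw [← sub_eq_zero, ← norm_eq_zero, ← sq_eq_zero_iff, @norm_sub_sq ℂ]
    have h1 : ‖N.adjoint (V x)‖ = ‖T.adjoint x‖ := by
      rw [← norm_map_eq_norm_adjoint_map hN, hV, V.norm_map, hx]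
    have h2 : inner ℂ (N.adjoint (V x)) (V (T.adjoint x)) = ((‖T.adjoint x‖ ^ 2 : ℝ) : ℂ) := by
      have h := adjoint_inner_left V.toContinuousLinearMap (T.adjoint x) (N.adjoint (V x))
      rw [hadj, inner_self_eq_norm_sq_to_K] at h
      push_cast
      exact h.symm
    rw [h1, h2, V.norm_map]
    norm_cast
    simp only [RCLike.re_to_complex, Complex.ofReal_re]
    ring
  have h3 : N.adjoint (V (T x)) = V (T (T.adjoint x)) := by
    rw [← hV, ← hV, ← hinv]
    exact congrArg (fun S : L →L[ℂ] L => S (V x)) hN.star_comm_self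
  have h4 : T.adjoint (T x) = T (T.adjoint x) := by rw [← hadj, h3, hVV]
  rw [← V.norm_map (T (T x)), ← hV, norm_map_eq_norm_adjoint_map hN, h3, V.norm_map, h4]

theorem range_adjoint_eq_of_finiteDimensional {R : H →L[ℂ] H}
    [FiniteDimensional ℂ R.range] :
    R.adjoint.range = R.ker.orthogonal ∧
      R.adjoint.range = R.range.map (R.adjoint : H →ₗ[ℂ] H) := by
  have h : R.adjoint.range = R.range.map (R.adjoint : H →ₗ[ℂ] H) := by
    refine le_antisymm ?_ (LinearMap.map_le_range)
    rintro _ ⟨x, rfl⟩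
    refine ⟨R.range.starProjection x, Submodule.starProjection_apply_mem _ _, ?_⟩
    have hx : x - R.range.starProjection x ∈ R.rangeᗮ :=
      Submodule.sub_starProjection_mem_orthogonal x
    rw [R.orthogonal_range] at hx
    have : R.adjoint (x - R.range.starProjection x) = 0 := hx
    rw [map_sub, sub_eq_zero] at this
    exact this.symm
  refine ⟨?_, h⟩
  have : FiniteDimensional ℂ R.adjoint.range := by rw [h]; infer_instance
  rw [R.orthogonal_ker]
  exact (Submodule.closed_of_finiteDimensional R.adjoint.range).submodule_topologicalClosure_eq.symm

variable {T V : H →L[ℂ] H}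

/-- When `T = V T† + R` with `V` an isometry and `V† T = T†`, the self-commutator `T† T - T T†` is
`R† R`. -/
theorem adjoint_comp_self_eq_defect (hV : V.adjoint ∘L V = 1) (hVT : V.adjoint ∘L T = T.adjoint) :
    T.adjoint ∘L T = (T - V ∘L T.adjoint).adjoint ∘L (T - V ∘L T.adjoint) + T ∘L T.adjoint := by
  have hTV : T.adjoint ∘L V = T := by
    have := congrArg adjoint hVT
    rwa [adjoint_comp, adjoint_adjoint, adjoint_adjoint] at this
  have e1 (x) : V.adjoint (V x) = x := congrArg (fun S : H →L[ℂ] H => S x) hV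
  have e2 (x) : V.adjoint (T x) = T.adjoint x := congrArg (fun S : H →L[ℂ] H => S x) hVT
  have e3 (x) : T.adjoint (V x) = T x := congrArg (fun S : H →L[ℂ] H => S x) hTV
  ext x
  simp [adjoint_comp, e1, e2, e3]

/-- The operator-theoretic core. With `R = T - V T†` of finite rank, subnormality makes
`range R† = (ker R)ᗮ` invariant under `T†`. On `ker V† ⊇ range R` the operators `R†` and `T†` agree,
so `range R† = T† (range R)`, and injectivity of `T†` turns the invariance into
`T† (ker V†) ⊆ range R ⊆ ker V†`. Taking adjoints gives `T V = V V† T V = V T`. -/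
theorem comp_comm_of_subnormal (hV : V.adjoint ∘L V = 1) (hVT : V.adjoint ∘L T = T.adjoint)
    (hsub : IsSubnormal T) (hinj : Function.Injective T.adjoint)
    [hfin : FiniteDimensional ℂ (T - V ∘L T.adjoint).range] : T ∘L V = V ∘L T := by
  have hself := adjoint_comp_self_eq_defect hV hVT
  have hTV : T.adjoint ∘L V = T := by
    have := congrArg adjoint hVT
    rwa [adjoint_comp, adjoint_adjoint, adjoint_adjoint] at this
  set R := T - V ∘L T.adjoint with hR
  have e1 (x) : V.adjoint (V x) = x := congrArg (fun S : H →L[ℂ] H => S x) hV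
  have e2 (x) : V.adjoint (T x) = T.adjoint x := congrArg (fun S : H →L[ℂ] H => S x) hVT
  have e3 (x) : T.adjoint (V x) = T x := congrArg (fun S : H →L[ℂ] H => S x) hTV
  have hVR (x) : V.adjoint (R x) = 0 := by simp [hR, e1, e2]
  have hRadj (x) (hx : V.adjoint x = 0) : R.adjoint x = T.adjoint x := by
    simp [hR, adjoint_comp, hx]
  have hnorm (x) : ‖T x‖ = ‖T.adjoint x‖ ↔ R x = 0 := by
    have h : T.adjoint (T x) = R.adjoint (R x) + T (T.adjoint x) :=
      congrArg (fun S : H →L[ℂ] H => S x) hself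
    replace h := congrArg (fun y => inner ℂ x y) h
    beta_reduce at h
    rw [inner_add_right, adjoint_inner_right, adjoint_inner_right,
      ← adjoint_inner_left T (T.adjoint x) x, inner_self_eq_norm_sq_to_K, inner_self_eq_norm_sq_to_K, inner_self_eq_norm_sq_to_K] at h
    have h' : ‖T x‖ ^ 2 = ‖R x‖ ^ 2 + ‖T.adjoint x‖ ^ 2 := by exact_mod_cast h
    rw [← norm_eq_zero, ← sq_eq_zero_iff, ← sq_eq_sq₀ (norm_nonneg _) (norm_nonneg _), h']
    constructor <;> intro h <;> linarith
  have hker (x) (hx : R x = 0) : R (T x) = 0 :=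
    (hnorm _).1 (hsub.norm_map_map ((hnorm x).2 hx))
  obtain ⟨hr1, hr2⟩ := range_adjoint_eq_of_finiteDimensional (R := R)
  -- Both `R† k = T† k` and the invariance of `range R†` are used; the injectivity of `T†` then
  -- identifies `T† k` with an element of `range R`.
  have hkerV (k) (hk : V.adjoint k = 0) : V.adjoint (T.adjoint k) = 0 := by
    have h1 : T.adjoint k ∈ R.adjoint.range := ⟨k, hRadj k hk⟩
    have h2 : T.adjoint (T.adjoint k) ∈ R.adjoint.range := by
      rw [hr1] at h1 ⊢
      intro y hy
      rw [adjoint_inner_right]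
      exact h1 _ (hker y hy)
    rw [hr2] at h2
    obtain ⟨_, ⟨y, rfl⟩, hy⟩ := h2
    have h3 : T.adjoint (R y) = T.adjoint (T.adjoint k) := (hRadj _ (hVR y)).symm.trans hy
    rw [← hinj h3]
    exact hVR y
  -- `V† T† (1 - V V†) = 0`; the adjoint of this identity is `(1 - V V†) T V = 0`.
  ext f
  refine ext_inner_left ℂ fun x => ?_
  have h := hkerV (x - V (V.adjoint x)) (by rw [map_sub, e1, sub_self])
  have h' : inner ℂ (V.adjoint (T.adjoint (x - V (V.adjoint x)))) f = 0 := by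
    rw [h, inner_zero_left]
  rw [map_sub, map_sub, inner_sub_left, sub_eq_zero, e3, e2, adjoint_inner_left,
    adjoint_inner_left, adjoint_inner_left, adjoint_inner_left] at h'
  exact h'

end Abstract

/-! ### Compressions to an invariant subspace of a unitary operator -/

section Compression

universe u

variable {E : Type u} [NormedAddCommGroup E] [InnerProductSpace ℂ E] [CompleteSpace E]

/-- The compression `P A|_K` of an operator `A` to a closed subspace `K`. -/
noncomputable def compression (K : Submodule ℂ E) [CompleteSpace K] (A : E →L[ℂ] E) : K →L[ℂ] K :=
  K.orthogonalProjectionOnto ∘L A ∘L K.subtypeL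

theorem compression_adjoint (K : Submodule ℂ E) [CompleteSpace K] (A : E →L[ℂ] E) :
    (compression K A).adjoint = compression K A.adjoint := by
  simp only [compression, adjoint_comp, Submodule.adjoint_subtypeL,
    Submodule.adjoint_orthogonalProjectionOnto]
  rfl

omit [CompleteSpace E] in
theorem compression_comp_of_invariant {K : Submodule ℂ E} [CompleteSpace K] {A B : E →L[ℂ] E}
    (hB : ∀ x ∈ K, B x ∈ K) : compression K (A ∘L B) = compression K A ∘L compression K B := by
  ext x
  simp [compression, Submodule.starProjection_eq_self_iff.2 (hB x x.2)]

/-- The abstract form of the theorem: `A` and `U` stand for multiplication by the symbol and by the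
inner function, and `K` for the Hardy space. The commutation relation of `comp_comm_of_subnormal`
says that `P U (1 - P) A` vanishes on `K`; the Hankel-type hypothesis `hhank` upgrades this to
`U† K ⊆ K`. Hence `V = U|_K` is unitary and `R = V V† R = 0`. -/
theorem isStarNormal_compression {K : Submodule ℂ E} [CompleteSpace K] {A U : E →L[ℂ] E}
    (hU : U.adjoint ∘L U = 1) (hU' : U ∘L U.adjoint = 1) (hAU : A = U ∘L A.adjoint)
    (hUK : ∀ x ∈ K, U x ∈ K)
    (hfin : FiniteDimensional ℂ (K.starProjection ∘L U ∘L Kᗮ.starProjection).range)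
    (hinj : Function.Injective (compression K A.adjoint))
    (hhank : ∀ v ∈ Kᗮ, A v ∈ Kᗮ → v = 0)
    (hsub : IsSubnormal (compression K A)) : IsStarNormal (compression K A) := by
  have hU1 (x) : U.adjoint (U x) = x := congrArg (fun S : E →L[ℂ] E => S x) hU
  have hU2 (x) : U (U.adjoint x) = x := congrArg (fun S : E →L[ℂ] E => S x) hU'
  have hA1 (x) : U (A.adjoint x) = A x := (congrArg (fun S : E →L[ℂ] E => S x) hAU).symm
  have hA2 : A.adjoint = A ∘L U.adjoint := by
    conv_lhs => rw [hAU]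
    rw [adjoint_comp, adjoint_adjoint]
  have hA3 (x) : A (U.adjoint x) = A.adjoint x :=
    (congrArg (fun S : E →L[ℂ] E => S x) hA2).symm
  have hcomm (x) : A (U x) = U (A x) := by rw [← hA1, ← hA3 (U x), hU1]
  set T := compression K A with hTdef
  set V := compression K U with hVdef
  have hVV : V.adjoint ∘L V = 1 := by
    rw [hVdef, compression_adjoint, ← compression_comp_of_invariant hUK, hU]
    ext x
    simp [compression]
  have hVT : V.adjoint ∘L T = T.adjoint := by
    rw [← adjoint_adjoint (V.adjoint ∘L T), adjoint_comp, adjoint_adjoint, hVdef, hTdef,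
      compression_adjoint, ← compression_comp_of_invariant hUK]
    have : A.adjoint ∘L U = A := by
      ext x
      change A.adjoint (U x) = A x
      rw [← hA3, hU1]
    rw [this, compression_adjoint]
  have hVcoe (x : K) : (V x : E) = U x := by
    simp [hVdef, compression, Submodule.starProjection_eq_self_iff.2 (hUK x x.2)]
  have hTcoe (x : K) : (T x : E) = K.starProjection (A x) := rfl
  have hTacoe (x : K) : (T.adjoint x : E) = K.starProjection (A.adjoint x) := by
    rw [hTdef, compression_adjoint]; rfl
  -- `P U (1 - P) y = P U y - U P y`, because `U` leaves `K` invariant.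
  have hdef (y : E) : K.starProjection (U (Kᗮ.starProjection y))
      = K.starProjection (U y) - U (K.starProjection y) := by
    rw [Submodule.starProjection_orthogonal_val, map_sub, map_sub,
      Submodule.starProjection_eq_self_iff.2 (hUK _ (Submodule.starProjection_apply_mem K y))]
  have hfin' : FiniteDimensional ℂ (T - V ∘L T.adjoint).range := by
    have hle : (T - V ∘L T.adjoint).range.map K.subtype
        ≤ (K.starProjection ∘L U ∘L Kᗮ.starProjection).range := by
      rintro _ ⟨_, ⟨x, rfl⟩, rfl⟩
      refine ⟨A.adjoint x, ?_⟩
      change K.starProjection (U (Kᗮ.starProjection (A.adjoint x))) = (T x : E) - V (T.adjoint x)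
      rw [hdef, hA1, hVcoe, hTacoe, hTcoe]
    have := Submodule.finiteDimensional_of_le hle
    exact (Submodule.equivMapOfInjective K.subtype K.injective_subtype _).symm.finiteDimensional
  have hTV := comp_comm_of_subnormal hVV hVT hsub
    (by rw [hTdef, compression_adjoint]; exact hinj)
  -- `T V f - V T f = P U (1 - P) A f`.
  have hzero (f : K) : K.starProjection (U (Kᗮ.starProjection (A f))) = 0 := by
    have h := congrArg (fun S : K →L[ℂ] K => (S f : E)) hTV
    change (T (V f) : E) = V (T f) at h
    rw [hTcoe, hVcoe, hVcoe, hTcoe, hcomm] at h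
    rw [hdef, h, sub_self]
  have hUperp (u) (hu : u ∈ Kᗮ) : U.adjoint u ∈ Kᗮ := fun y hy => by
    rw [adjoint_inner_right]
    exact hu _ (hUK y hy)
  have hUadj (k) (hk : k ∈ K) : U.adjoint k ∈ K := by
    set w := Kᗮ.starProjection (U.adjoint k) with hw
    have hwK : w ∈ Kᗮ := Submodule.starProjection_apply_mem _ _
    -- `⟪A f, w⟫ = ⟪P U (1 - P) A f, k⟫ = 0` for `f ∈ K`.
    have hAw : A.adjoint w ∈ Kᗮ := fun f hf => by
      have h : inner ℂ (K.starProjection (U (Kᗮ.starProjection (A f)))) k = 0 := by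
        rw [hzero ⟨f, hf⟩, inner_zero_left]
      rw [K.starProjection_isSymmetric.apply_clm, Submodule.starProjection_eq_self_iff.2 hk,
        ← adjoint_inner_right, Kᗮ.starProjection_isSymmetric.apply_clm] at h
      rw [adjoint_inner_right]
      exact h
    have h0 := hhank _ (hUperp w hwK) (by rw [hA3]; exact hAw)
    have h1 : w = 0 := by rw [← hU2 w, h0, map_zero]
    rw [hw, Submodule.starProjection_orthogonal_val, sub_eq_zero] at h1
    rw [h1]
    exact Submodule.starProjection_apply_mem _ _
  have hVV' (x : K) : V (V.adjoint x) = x := by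
    apply Subtype.ext
    rw [hVcoe, hVdef, compression_adjoint]
    change U (K.starProjection (U.adjoint x)) = x
    rw [Submodule.starProjection_eq_self_iff.2 (hUadj x x.2), hU2]
  -- The defect is `T - V V† T`, and `V V† = 1`.
  have hT0 : T - V ∘L T.adjoint = 0 := by
    ext x
    have : V.adjoint (T x) = T.adjoint x := congrArg (fun S : K →L[ℂ] K => S x) hVT
    simp [← this, hVV']
  have := adjoint_comp_self_eq_defect hVV hVT
  rw [hT0, comp_zero, zero_add] at this
  exact ⟨this⟩

end Compression

/-! ### Multiplication operators -/

section Multiplication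

variable {n : ℕ}

theorem matrixAction_mul (A B : Matrix (Fin n) (Fin n) ℂ) (x : EuclideanSpace ℂ (Fin n)) :
    matrixAction n (A * B) x = matrixAction n A (matrixAction n B x) := by
  change Matrix.toEuclideanCLM (n := Fin n) (𝕜 := ℂ) (A * B) x = _
  rw [map_mul]
  rfl

theorem matrixAction_one (x : EuclideanSpace ℂ (Fin n)) : matrixAction n 1 x = x := by
  change Matrix.toEuclideanCLM (n := Fin n) (𝕜 := ℂ) 1 x = _
  rw [map_one]
  rfl

theorem inner_matrixAction_conjTranspose (A : Matrix (Fin n) (Fin n) ℂ)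
    (x y : EuclideanSpace ℂ (Fin n)) :
    inner ℂ (matrixAction n Aᴴ x) y = inner ℂ x (matrixAction n A y) := by
  change inner ℂ (Matrix.toEuclideanCLM (n := Fin n) (𝕜 := ℂ) (star A) x) y = _
  rw [map_star, star_eq_adjoint, adjoint_inner_left]
  rfl

theorem coeFn_mulOp {Φ : UnitAddCircle → Matrix (Fin n) (Fin n) ℂ}
    (hΦ : MemLp Φ ∞ circleMeasure) (f : L2 n) :
    mulOp Φ hΦ f =ᵐ[circleMeasure] fun t => matrixAction n (Φ t) (f t) := by
  filter_upwards [(matrixAction n).coeFn_holder (r := 2) (hΦ.toLp Φ) f, hΦ.coeFn_toLp] with t h1 h2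
  rw [← h2]
  exact h1

theorem mulOp_comp_mulOp {Φ Ψ Θ : UnitAddCircle → Matrix (Fin n) (Fin n) ℂ}
    (hΦ : MemLp Φ ∞ circleMeasure) (hΨ : MemLp Ψ ∞ circleMeasure) (hΘ : MemLp Θ ∞ circleMeasure)
    (h : ∀ᵐ t ∂circleMeasure, Φ t * Ψ t = Θ t) : mulOp Φ hΦ ∘L mulOp Ψ hΨ = mulOp Θ hΘ := by
  ext1 f
  refine Lp.ext ?_
  filter_upwards [h, coeFn_mulOp hΦ (mulOp Ψ hΨ f), coeFn_mulOp hΨ f, coeFn_mulOp hΘ f]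
    with t h h1 h2 h3
  rw [h3, ← h, matrixAction_mul, ← h2, ← h1]
  rfl

theorem mulOp_one (h : MemLp (fun _ => (1 : Matrix (Fin n) (Fin n) ℂ)) ∞ circleMeasure) :
    mulOp (fun _ => (1 : Matrix (Fin n) (Fin n) ℂ)) h = 1 := by
  ext1 f
  refine Lp.ext ?_
  filter_upwards [coeFn_mulOp h f] with t h1
  rw [h1, matrixAction_one]
  rfl

theorem adjoint_mulOp {Φ : UnitAddCircle → Matrix (Fin n) (Fin n) ℂ}
    (hΦ : MemLp Φ ∞ circleMeasure) :
    (mulOp Φ hΦ).adjoint = mulOp (fun t => (Φ t)ᴴ) (memLp_conjTranspose hΦ) := by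
  symm
  rw [eq_adjoint_iff]
  intro f g
  rw [L2.inner_def, L2.inner_def]
  refine integral_congr_ae ?_
  filter_upwards [coeFn_mulOp hΦ g, coeFn_mulOp (memLp_conjTranspose hΦ) f] with t h1 h2
  rw [h1, h2, inner_matrixAction_conjTranspose]

end Multiplication

/-! ### Fourier coefficients of vector-valued functions -/

section FourierCoefficients

theorem integrable_fourier_smul {E : Type*} [NormedAddCommGroup E] [NormedSpace ℂ E]
    {f : UnitAddCircle → E} (hf : Integrable f circleMeasure) (k : ℤ) :
    Integrable (fun t => fourier k t • f t) circleMeasure :=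
  hf.bdd_smul 1 (fourier k).continuous.aestronglyMeasurable
    (Filter.Eventually.of_forall fun t => by
      rw [fourier_apply, Circle.norm_coe])

theorem fourierCoeff_clm_comp {E F : Type*} [NormedAddCommGroup E] [NormedSpace ℂ E]
    [CompleteSpace E] [NormedAddCommGroup F] [NormedSpace ℂ F] [CompleteSpace F] (C : E →L[ℂ] F)
    {f : UnitAddCircle → E} (hf : Integrable f circleMeasure) (k : ℤ) :
    fourierCoeff (fun t => C (f t)) k = C (fourierCoeff f k) := by
  unfold fourierCoeff
  rw [← C.integral_comp_comm (integrable_fourier_smul hf _)]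
  simp only [map_smul]

theorem fourierCoeff_fourier_smul {E : Type*} [NormedAddCommGroup E] [NormedSpace ℂ E]
    (f : UnitAddCircle → E) (j k : ℤ) :
    fourierCoeff (fun t => fourier j t • f t) k = fourierCoeff f (k - j) := by
  unfold fourierCoeff
  refine integral_congr_ae (Filter.Eventually.of_forall fun t => ?_)
  beta_reduce
  rw [smul_smul, ← fourier_add]
  congr 3
  ring

variable {n : ℕ}

theorem fourierCoeff_apply {f : UnitAddCircle → EuclideanSpace ℂ (Fin n)}
    (hf : Integrable f circleMeasure) (k : ℤ) (i : Fin n) :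
    fourierCoeff f k i = fourierCoeff (fun t => f t i) k :=
  (fourierCoeff_clm_comp (EuclideanSpace.proj (𝕜 := ℂ) i) hf k).symm

theorem eq_zero_of_fourierCoeff_eq_zero {f : L2 n} (hf : ∀ k, fourierCoeff f k = 0) : f = 0 := by
  have h (i : Fin n) : (fun t => f t i) =ᵐ[circleMeasure] 0 := by
    have hm : MemLp (fun t => f t i) 2 circleMeasure :=
      (EuclideanSpace.proj (𝕜 := ℂ) i).comp_memLp' (Lp.memLp f)
    have h0 : hm.toLp = 0 := by
      apply fourierBasis.repr.injective
      ext k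
      rw [fourierBasis_repr, fourierCoeff_congr_ae hm.coeFn_toLp,
        ← fourierCoeff_apply (integrable_L2 f), hf k, map_zero]
      rfl
    refine hm.coeFn_toLp.symm.trans ?_
    rw [h0]
    exact Lp.coeFn_zero _ _ _
  refine Lp.ext ?_
  filter_upwards [ae_all_iff.2 h, Lp.coeFn_zero (EuclideanSpace ℂ (Fin n)) 2 circleMeasure]
    with t ht h0
  rw [h0]
  ext i
  exact ht i

theorem fourierCoeff_eq_zero_of_mem_H2_orthogonal {v : L2 n} (hv : v ∈ (H2 n)ᗮ) {k : ℤ}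
    (hk : 0 ≤ k) : fourierCoeff v k = 0 := by
  refine ext_inner_left ℂ fun e => ?_
  rw [inner_zero_right]
  have hm : MemLp (fun t : UnitAddCircle => fourier k t • e) 2 circleMeasure :=
    (Continuous.memLp_top_of_hasCompactSupport (by fun_prop)
      (HasCompactSupport.of_compactSpace _) _).mono_exponent le_top
  have hH : hm.toLp ∈ H2 n := fun j hj => by
    have hc := fourierCoeff_clm_comp (ContinuousLinearMap.toSpanSingleton ℂ e)
      (f := fourier (T := 1) k) ((fourier k).continuous.integrable_of_hasCompactSupport
        (HasCompactSupport.of_compactSpace _)) j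
    simp only [toSpanSingleton_apply] at hc
    rw [fourierCoeff_congr_ae hm.coeFn_toLp, hc, fourierCoeff_fourier,
      Pi.single_eq_of_ne (by omega), zero_smul]
  have h := hv _ hH
  rw [L2.inner_def] at h
  rw [← h, fourierCoeff, ← integral_inner (integrable_fourier_smul (integrable_L2 v) _)]
  refine integral_congr_ae ?_
  filter_upwards [hm.coeFn_toLp] with t ht
  rw [ht, inner_smul_left, inner_smul_right, fourier_neg]

end FourierCoefficients

/-! ### Conjugation and the kernel of a Hankel operator -/

section Hankel

variable {n : ℕ}

/-- The entrywise complex conjugate of a vector in `ℂⁿ`. -/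
def conjVec (x : EuclideanSpace ℂ (Fin n)) : EuclideanSpace ℂ (Fin n) :=
  WithLp.toLp 2 fun i => star (x i)

theorem norm_conjVec (x : EuclideanSpace ℂ (Fin n)) : ‖conjVec x‖ = ‖x‖ := by
  simp [EuclideanSpace.norm_eq, conjVec]

theorem matrixAction_map_star_conjVec (A : Matrix (Fin n) (Fin n) ℂ)
    (x : EuclideanSpace ℂ (Fin n)) :
    matrixAction n (A.map star) (conjVec x) = conjVec (matrixAction n A x) := by
  ext i
  change (A.map star *ᵥ fun i => star (x i)) i = star ((A *ᵥ x) i)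
  simp [Matrix.mulVec, dotProduct]

theorem memLp_conj_smul_conjVec (v : L2 n) :
    MemLp (fun t => fourier (-1) t • conjVec (v t)) 2 circleMeasure := by
  refine (Lp.memLp v).of_le ((fourier (-1)).continuous.aestronglyMeasurable.smul
    (Continuous.comp_aestronglyMeasurable (g := conjVec) ?_ (Lp.aestronglyMeasurable v)))
    (Filter.Eventually.of_forall fun t => ?_)
  · unfold conjVec
    fun_prop
  · rw [norm_smul, fourier_apply, Circle.norm_coe, one_mul, norm_conjVec]

/-- The conjugate-linear isometry `v ↦ conj z • conj v` of `L²`, which exchanges `H²` and its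
orthogonal complement. -/
noncomputable def conjFlip (v : L2 n) : L2 n := (memLp_conj_smul_conjVec v).toLp

theorem coeFn_conjFlip (v : L2 n) :
    conjFlip v =ᵐ[circleMeasure] fun t => fourier (-1) t • conjVec (v t) :=
  (memLp_conj_smul_conjVec v).coeFn_toLp

theorem norm_conjFlip (v : L2 n) : ‖conjFlip v‖ = ‖v‖ := by
  rw [Lp.norm_def, Lp.norm_def]
  congr 1
  refine eLpNorm_congr_norm_ae ?_
  filter_upwards [coeFn_conjFlip v] with t ht
  rw [ht, norm_smul, fourier_apply, Circle.norm_coe, one_mul, norm_conjVec]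

theorem fourierCoeff_conjFlip (v : L2 n) (k : ℤ) :
    fourierCoeff (conjFlip v) k = conjVec (fourierCoeff v (-k - 1)) := by
  ext i
  change _ = star (fourierCoeff v (-k - 1) i)
  rw [fourierCoeff_apply (integrable_L2 _), fourierCoeff_apply (integrable_L2 _), fourierCoeff,
    fourierCoeff]
  refine Eq.trans ?_ integral_conj
  refine integral_congr_ae ?_
  filter_upwards [coeFn_conjFlip v] with t ht
  rw [ht]
  change fourier (-k) t * (fourier (-1) t * star (v t i)) = _
  rw [← mul_assoc, ← fourier_add, smul_eq_mul, map_mul, ← fourier_neg]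
  congr 3
  ring

theorem conjFlip_mem_H2 {v : L2 n} (hv : v ∈ (H2 n)ᗮ) : conjFlip v ∈ H2 n := fun k hk => by
  rw [fourierCoeff_conjFlip, fourierCoeff_eq_zero_of_mem_H2_orthogonal hv (by omega),
    ← norm_eq_zero, norm_conjVec, norm_zero]

theorem mulOp_map_star_conjFlip {Φ : UnitAddCircle → Matrix (Fin n) (Fin n) ℂ}
    (hΦ : MemLp Φ ∞ circleMeasure) (v : L2 n) :
    mulOp (fun t => (Φ t).map star) (memLp_map_star hΦ) (conjFlip v)
      = conjFlip (mulOp Φ hΦ v) := by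
  refine Lp.ext ?_
  filter_upwards [coeFn_mulOp (memLp_map_star hΦ) (conjFlip v), coeFn_mulOp hΦ v, coeFn_conjFlip v,
    coeFn_conjFlip (mulOp Φ hΦ v)] with t h1 h2 h3 h4
  rw [h1, h3, h4, h2, map_smul, matrixAction_map_star_conjVec]

/-- Injectivity of the Hankel operator with symbol `conj Φ` says that no nonzero `v ⊥ H²` satisfies
`Φ v ⊥ H²`: apply the Hankel operator to `conjFlip v ∈ H²`. -/
theorem eq_zero_of_mulOp_mem_orthogonal {Φ : UnitAddCircle → Matrix (Fin n) (Fin n) ℂ}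
    (hΦ : MemLp Φ ∞ circleMeasure)
    (hH : Function.Injective (hankel (fun t => (Φ t).map star) (memLp_map_star hΦ)))
    {v : L2 n} (hv : v ∈ (H2 n)ᗮ) (hΦv : mulOp Φ hΦ v ∈ (H2 n)ᗮ) : v = 0 := by
  have h : hankel (fun t => (Φ t).map star) (memLp_map_star hΦ) ⟨conjFlip v, conjFlip_mem_H2 hv⟩
      = 0 := by
    change flipOp n ((H2 n)ᗮ.starProjection
      (mulOp (fun t => (Φ t).map star) (memLp_map_star hΦ) (conjFlip v))) = 0
    rw [mulOp_map_star_conjFlip hΦ, Submodule.starProjection_orthogonal_val,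
      Submodule.starProjection_eq_self_iff.2 (conjFlip_mem_H2 hΦv), sub_self, map_zero]
  have h0 : conjFlip v = 0 := congrArg Subtype.val (hH (h.trans (map_zero _).symm))
  rw [← norm_eq_zero, ← norm_conjFlip, h0, norm_zero]

end Hankel

/-! ### Blaschke–Potapov products -/

section Inner

variable {n : ℕ}

theorem memLp_top_of_continuous {G : UnitAddCircle → Matrix (Fin n) (Fin n) ℂ}
    (hG : Continuous G) : MemLp G ∞ circleMeasure :=
  hG.memLp_top_of_hasCompactSupport (HasCompactSupport.of_compactSpace _) _

/-- A continuous inner function (unitary values on the circle, multiplication maps `H²` into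
itself) such that `f ↦ P (G f)` has finite rank on the orthogonal complement of `H²`. -/
structure IsFiniteRankInner (G : UnitAddCircle → Matrix (Fin n) (Fin n) ℂ) : Prop where
  continuous : Continuous G
  mem_unitary : ∀ t, G t ∈ Matrix.unitaryGroup (Fin n) ℂ
  mulOp_mem : ∀ f ∈ H2 n, mulOp G (memLp_top_of_continuous continuous) f ∈ H2 n
  finiteDimensional : FiniteDimensional ℂ ((H2 n).starProjection ∘L
    mulOp G (memLp_top_of_continuous continuous) ∘L (H2 n)ᗮ.starProjection).range

theorem IsFiniteRankInner.mul {F G : UnitAddCircle → Matrix (Fin n) (Fin n) ℂ}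
    (hF : IsFiniteRankInner F) (hG : IsFiniteRankInner G) :
    IsFiniteRankInner fun t => F t * G t := by
  have hc : Continuous fun t => F t * G t := hF.continuous.mul hG.continuous
  have hcomp := mulOp_comp_mulOp (memLp_top_of_continuous hF.continuous)
    (memLp_top_of_continuous hG.continuous) (memLp_top_of_continuous hc)
    (Filter.Eventually.of_forall fun t => rfl)
  refine ⟨hc, fun t => mul_mem (hF.mem_unitary t) (hG.mem_unitary t), ?_, ?_⟩
  · intro f hf
    rw [← hcomp]
    exact hF.mulOp_mem _ (hG.mulOp_mem f hf)
  · rw [← hcomp]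
    have := hF.finiteDimensional
    have := hG.finiteDimensional
    set A := mulOp F (memLp_top_of_continuous hF.continuous)
    set B := mulOp G (memLp_top_of_continuous hG.continuous)
    -- `P F G (1 - P) = P F (P G (1 - P)) + (P F (1 - P)) G (1 - P)`.
    refine Submodule.finiteDimensional_of_le (S₂ :=
      ((H2 n).starProjection ∘L B ∘L (H2 n)ᗮ.starProjection).range.map
        (((H2 n).starProjection ∘L A : L2 n →L[ℂ] L2 n) : L2 n →ₗ[ℂ] L2 n)
      ⊔ ((H2 n).starProjection ∘L A ∘L (H2 n)ᗮ.starProjection).range) ?_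
    rintro _ ⟨u, rfl⟩
    set w := B ((H2 n)ᗮ.starProjection u) with hw
    refine Submodule.mem_sup.2 ⟨(H2 n).starProjection (A ((H2 n).starProjection w)),
      ⟨_, ⟨u, rfl⟩, rfl⟩, (H2 n).starProjection (A ((H2 n)ᗮ.starProjection w)), ⟨w, rfl⟩, ?_⟩
    rw [← map_add, ← map_add, Submodule.starProjection_orthogonal_val, add_sub_cancel]
    rfl

/-- If `(1 - a z) G(z) = C₀ + z C₁`, the Fourier coefficients of `w = G u` satisfy a
first-order recursion driven by those of `u`. -/
theorem fourierCoeff_mulOp_recursion {G : UnitAddCircle → Matrix (Fin n) (Fin n) ℂ}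
    (hG : MemLp G ∞ circleMeasure) {a : ℂ} {C₀ C₁ : Matrix (Fin n) (Fin n) ℂ}
    (h : ∀ t, G t - (a * fourier 1 t) • G t = C₀ + fourier 1 t • C₁) (u : L2 n) (k : ℤ) :
    fourierCoeff (mulOp G hG u) k - a • fourierCoeff (mulOp G hG u) (k - 1)
      = matrixAction n C₀ (fourierCoeff u k) + matrixAction n C₁ (fourierCoeff u (k - 1)) := by
  have hu := integrable_L2 u
  set w := mulOp G hG u
  have hw := integrable_L2 w
  have h1 : (fun t => w t + (-a) • (fourier 1 t • w t)) =ᵐ[circleMeasure]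
      fun t => matrixAction n C₀ (u t) + fourier 1 t • matrixAction n C₁ (u t) := by
    filter_upwards [coeFn_mulOp hG u] with t ht
    have ht' := congrArg (fun C => matrixAction n C (u t)) (h t)
    simp only [map_sub, map_add, map_smul, sub_apply, add_apply, smul_apply] at ht'
    rw [ht, ← ht']
    module
  have h2 := congrFun (fourierCoeff_congr_ae h1) k
  have i1 : Integrable (fun t => (-a) • (fourier 1 t • w t)) circleMeasure :=
    (integrable_fourier_smul hw 1).smul (-a)
  have i2 : Integrable (fun t => matrixAction n C₀ (u t)) circleMeasure :=
    (matrixAction n C₀).integrable_comp hu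
  have i3 : Integrable (fun t => matrixAction n C₁ (u t)) circleMeasure :=
    (matrixAction n C₁).integrable_comp hu
  have e1 := congrFun (fourierCoeff.add hw i1) k
  have e2 := congrFun (fourierCoeff.add i2 (integrable_fourier_smul i3 1)) k
  have e3 := fourierCoeff.const_smul (fun t => fourier 1 t • w t) (-a) k
  simp only [Pi.add_apply] at e1 e2
  rw [fourierCoeff_fourier_smul] at e3
  rw [fourierCoeff_fourier_smul, fourierCoeff_clm_comp _ hu, fourierCoeff_clm_comp _ hu] at e2
  rw [← e2, sub_eq_add_neg, ← neg_smul, ← e3]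
  exact e1.symm.trans h2

/-- For `u ∈ H²` the recursion is `ŵ(k) = a ŵ(k - 1)` at `k < 0`; as the coefficients of `w = G u`
are bounded and `‖a‖ < 1`, it forces `ŵ(k) = 0` there. For `u ⊥ H²` it holds at `k ≥ 1`, so `P w` is
determined by `ŵ(0)`, and the rank is at most `n`. -/
theorem isFiniteRankInner_of_recursion {G : UnitAddCircle → Matrix (Fin n) (Fin n) ℂ}
    (hG : Continuous G) (hU : ∀ t, G t ∈ Matrix.unitaryGroup (Fin n) ℂ) {a : ℂ} (ha : ‖a‖ < 1)
    {C₀ C₁ : Matrix (Fin n) (Fin n) ℂ}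
    (h : ∀ t, G t - (a * fourier 1 t) • G t = C₀ + fourier 1 t • C₁) : IsFiniteRankInner G := by
  have hrec := fourierCoeff_mulOp_recursion (memLp_top_of_continuous hG) h
  set A := mulOp G (memLp_top_of_continuous hG) with hA
  refine ⟨hG, hU, ?_, ?_⟩
  · intro f hf k hk
    have hstep (j : ℤ) (hj : j < 0) : fourierCoeff (A f) j = a • fourierCoeff (A f) (j - 1) := by
      have := hrec f j
      rwa [hf j hj, hf (j - 1) (by omega), map_zero, map_zero, add_zero, sub_eq_zero] at this
    have hpow (m : ℕ) : fourierCoeff (A f) k = a ^ m • fourierCoeff (A f) (k - m) := by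
      induction m with
      | zero => simp
      | succ m ih =>
        rw [ih, hstep _ (by omega), smul_smul, pow_succ, Nat.cast_succ, sub_sub]
    have hbd (m : ℕ) : ‖fourierCoeff (A f) k‖ ≤ ‖a‖ ^ m * ‖A f‖ := by
      rw [hpow m, norm_smul, norm_pow]
      gcongr
      have : ‖fourierCoeffL n (k - m) (A f)‖ ≤ 1 * ‖A f‖ :=
        (fourierCoeffL n (k - m)).le_of_opNorm_le (LinearMap.mkContinuous_norm_le _ zero_le_one _) _
      rwa [one_mul] at this
    have hlim : Filter.Tendsto (fun m : ℕ => ‖a‖ ^ m * ‖A f‖) Filter.atTop (nhds 0) := by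
      simpa using (tendsto_pow_atTop_nhds_zero_of_lt_one (norm_nonneg a) ha).mul_const ‖A f‖
    exact norm_le_zero_iff.1 (ge_of_tendsto' hlim hbd)
  · set S := (H2 n).starProjection ∘L A ∘L (H2 n)ᗮ.starProjection
    refine FiniteDimensional.of_injective
      ((fourierCoeffL n 0 : L2 n →ₗ[ℂ] EuclideanSpace ℂ (Fin n)) ∘ₗ S.range.subtype) ?_
    rw [← LinearMap.ker_eq_bot, LinearMap.ker_eq_bot']
    rintro ⟨_, u, rfl⟩ h0
    replace h0 : fourierCoeff (S u) 0 = 0 := h0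
    apply Subtype.ext
    change S u = 0
    set v := (H2 n)ᗮ.starProjection u with hv
    have hvm : v ∈ (H2 n)ᗮ := Submodule.starProjection_apply_mem _ _
    have hcoef (k : ℤ) (hk : 0 ≤ k) : fourierCoeff (S u) k = fourierCoeff (A v) k := by
      have h1 : A v - S u ∈ (H2 n)ᗮ := Submodule.sub_starProjection_mem_orthogonal _
      have h2 : fourierCoeffL n k (A v - S u) = 0 :=
        fourierCoeff_eq_zero_of_mem_H2_orthogonal h1 hk
      rw [map_sub, sub_eq_zero] at h2
      exact h2.symm
    have hpos (m : ℕ) : fourierCoeff (S u) m = 0 := by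
      induction m with
      | zero => exact h0
      | succ m ih =>
        rw [hcoef _ (by omega)] at ih ⊢
        have := hrec v (m + 1 : ℕ)
        rwa [fourierCoeff_eq_zero_of_mem_H2_orthogonal hvm (by omega),
          fourierCoeff_eq_zero_of_mem_H2_orthogonal hvm (by omega), map_zero, map_zero, add_zero,
          Nat.cast_succ, add_sub_cancel_right, ih, smul_zero, sub_zero] at this
    refine eq_zero_of_fourierCoeff_eq_zero fun k => ?_
    rcases lt_or_ge k 0 with hk | hk
    · exact (Submodule.starProjection_apply_mem (H2 n) _ : S u ∈ H2 n) k hk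
    · lift k to ℕ using hk
      exact hpos k

theorem isFiniteRankInner_const {v : Matrix (Fin n) (Fin n) ℂ}
    (hv : v ∈ Matrix.unitaryGroup (Fin n) ℂ) :
    IsFiniteRankInner fun _ : UnitAddCircle => v :=
  isFiniteRankInner_of_recursion continuous_const (fun _ => hv) (a := 0) (by simp)
    (C₀ := v) (C₁ := 0) (by simp)

theorem one_sub_conj_mul_ne_zero {α z : ℂ} (hα : ‖α‖ < 1) (hz : ‖z‖ = 1) :
    1 - star α * z ≠ 0 := by
  intro h
  have : ‖star α * z‖ = 1 := by rw [← sub_eq_zero.1 h, norm_one]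
  rw [norm_mul, norm_star, hz, mul_one] at this
  exact hα.ne this

theorem star_mul_self_blaschkeFactor {α z : ℂ} (hα : ‖α‖ < 1) (hz : ‖z‖ = 1) :
    star (blaschkeFactor α z) * blaschkeFactor α z = 1 := by
  have h0 := one_sub_conj_mul_ne_zero hα hz
  have hzz : star z * z = 1 := by
    have := RCLike.conj_mul z
    rw [hz] at this
    simpa using this
  rw [blaschkeFactor, star_div₀, div_mul_div_comm, div_eq_one_iff_eq
    (mul_ne_zero (star_ne_zero.2 h0) h0)]
  simp only [star_sub, star_mul', star_star, star_one]
  linear_combination (1 - star α * α) * hzz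

theorem isFiniteRankInner_blaschkePotapov_factor {α : ℂ} (hα : ‖α‖ < 1)
    {P : Matrix (Fin n) (Fin n) ℂ} (hP : IsStarProjection P) :
    IsFiniteRankInner fun t => blaschkeFactor α (toCircle t) • P + (1 - P) := by
  have h0 (t : UnitAddCircle) := one_sub_conj_mul_ne_zero hα (Circle.norm_coe (toCircle t))
  refine isFiniteRankInner_of_recursion ?_ ?_ (a := star α) (by rwa [norm_star])
    (C₀ := -α • P + (1 - P)) (C₁ := P - star α • (1 - P)) ?_
  · have hz : Continuous fun t : UnitAddCircle => (toCircle t : ℂ) :=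
      continuous_subtype_val.comp continuous_toCircle
    unfold blaschkeFactor
    exact (((hz.sub continuous_const).div (continuous_const.sub (continuous_const.mul hz))
      h0).smul continuous_const).add continuous_const
  · intro t
    rw [Matrix.mem_unitaryGroup_iff']
    have hb := star_mul_self_blaschkeFactor hα (Circle.norm_coe (toCircle t))
    have h1 : star P = P := hP.isSelfAdjoint
    have h2 : P * P = P := hP.isIdempotentElem
    simp only [star_add, star_smul, star_sub, star_one, h1, add_mul, mul_add, sub_mul, mul_sub,
      h2, mul_one, one_mul, smul_mul_assoc, mul_smul_comm]
    linear_combination (norm := module) congrArg (fun c : ℂ => c • P) hb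
  · intro t
    have hb : (1 - star α * toCircle t) * blaschkeFactor α (toCircle t) = toCircle t - α := by
      rw [blaschkeFactor, mul_div_cancel₀ _ (h0 t)]
    rw [fourier_one]
    linear_combination (norm := module) congrArg (fun c : ℂ => c • P) hb

theorem IsFiniteBlaschkePotapov.isFiniteRankInner {Q : ℂ → Matrix (Fin n) (Fin n) ℂ}
    (hQ : IsFiniteBlaschkePotapov Q) : IsFiniteRankInner fun t => Q (toCircle t) := by
  obtain ⟨v, M, α, P, hv, hα, hP, hQ⟩ := hQ
  have hprod : ∀ l : List (UnitAddCircle → Matrix (Fin n) (Fin n) ℂ),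
      (∀ G ∈ l, IsFiniteRankInner G) → IsFiniteRankInner fun t => (l.map fun G => G t).prod := by
    intro l
    induction l with
    | nil => exact fun _ => isFiniteRankInner_const (one_mem _)
    | cons G l ih =>
      intro h
      simp only [List.map_cons, List.prod_cons]
      exact (h G (by simp)).mul (ih fun F hF => h F (by simp [hF]))
  have h := (isFiniteRankInner_const hv).mul (hprod (List.ofFn fun m t =>
    blaschkeFactor (α m) (toCircle t) • P m + (1 - P m)) (by
      intro G hG
      obtain ⟨m, rfl⟩ := List.mem_ofFn.1 hG
      exact isFiniteRankInner_blaschkePotapov_factor (hα m) (hP m)))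
  convert h using 2 with t
  rw [hQ _ (Circle.norm_coe _).le, List.map_ofFn]
  rfl

end Inner

end BlockToeplitz

theorem theorem2p2 (n : ℕ) (Φ : UnitAddCircle → Matrix (Fin n) (Fin n) ℂ)
    (hΦ : MemLp Φ ∞ BlockToeplitz.circleMeasure)
    (Q : ℂ → Matrix (Fin n) (Fin n) ℂ) (hQ : BlockToeplitz.IsFiniteBlaschkePotapov Q)
    (hΦQ : ∀ᵐ t ∂BlockToeplitz.circleMeasure, Φ t = Q (toCircle t) * (Φ t)ᴴ)
    (hbt : ¬ BlockToeplitz.IsBoundedTypeMatrix (fun t => (Φ t)ᴴ))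
    (hT : Function.Injective
      (BlockToeplitz.toeplitz (fun t => (Φ t)ᴴ) (BlockToeplitz.memLp_conjTranspose hΦ)))
    (hH : Function.Injective
      (BlockToeplitz.hankel (fun t => (Φ t).map star) (BlockToeplitz.memLp_map_star hΦ)))
    (hsub : BlockToeplitz.IsSubnormal (BlockToeplitz.toeplitz Φ hΦ)) :
    IsStarNormal (BlockToeplitz.toeplitz Φ hΦ) := by
  open BlockToeplitz in
  have hI := hQ.isFiniteRankInner
  have hQm := memLp_top_of_continuous hI.continuous
  have h1 : MemLp (fun _ => (1 : Matrix (Fin n) (Fin n) ℂ)) ∞ circleMeasure :=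
    memLp_top_of_continuous continuous_const
  refine isStarNormal_compression (U := mulOp _ hQm) ?_ ?_ ?_ hI.mulOp_mem hI.finiteDimensional ?_
    (fun v hv hv' => eq_zero_of_mulOp_mem_orthogonal hΦ hH hv hv') hsub
  · rw [adjoint_mulOp, ← mulOp_one h1]
    exact mulOp_comp_mulOp _ _ _ (Filter.Eventually.of_forall fun t =>
      Matrix.mem_unitaryGroup_iff'.1 (hI.mem_unitary t))
  · rw [adjoint_mulOp, ← mulOp_one h1]
    exact mulOp_comp_mulOp _ _ _ (Filter.Eventually.of_forall fun t =>
      Matrix.mem_unitaryGroup_iff.1 (hI.mem_unitary t))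
  · rw [adjoint_mulOp]
    refine (mulOp_comp_mulOp _ _ _ ?_).symm
    filter_upwards [hΦQ] with t ht using ht.symm
  · rw [adjoint_mulOp]
    exact hT
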